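/- **Theorem (Beth definability for continuous logic).** Let $\mathcal L$ be a many-sorted metric language: each sort $S$ carries a metric symbol $d_S$ with a diameter bound $B_S>0$; function symbols (including constants) carry a finite tuple of sorts as domain, a sort as co-domain and a uniform continuity modulus; relation symbols carry a finite tuple of sorts as domain, a bound and a uniform continuity modulus. (A uniform continuity modulus is an increasing continuous function $\delta:[0,1]\to[0,1]$ with $\lim_{\epsilon\to0^+}\delta(\epsilon)=0$ and $\delta(\epsilon)>0$ for $\epsilon>0$.) $\mathcal L$-structures interpret the sorts as non-empty complete metric spaces of diameter at most $B_S$ and the symbols as functions, respectively real-valued functions, that respect the given bounds and moduli. Basic $\mathcal L$-formulas are built from atomic formulas ($d_S(\tau_1,\tau_2)$ and $R(\tau_1,\dots,\tau_n)$ for terms $\tau_i$) by means of continuous connectives $f:\mathbb R^k\to\mathbb R$ and the quantifiers $\sup_x$, $\inf_x$. An $\mathcal L$-theory $T$ is a set of basic $\mathcal L$-sentences; its models are the $\mathcal L$-structures in which all sentences of $T$ have value $0$. An $\mathcal L$-formula in a finite tuple $\bar x$ of sorted variables is an element of the completion of the space of basic $\mathcal L$-formulas $\varphi(\bar x)$ with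 respect to the seminorm $\|\varphi\|=\sup\{|\varphi^{\mathcal M}(\bar a)| : \mathcal M \text{ an } \mathcal L\text{-structure},\ \bar a\in\mathcal M\}$; it is interpreted in structures as the uniform limit of the interpretations of basic formulas that converge to it. Let $\mathrm{Mod}(T)$ be the category of models of $T$ with elementary embeddings (maps that preserve the values of all basic formulas) as morphisms, and let $\mathrm{Str}(\mathcal L')$ be the category of all $\mathcal L'$-structures with elementary embeddings as morphisms. Let $\mathcal L'\subseteq\mathcal L$ be a sublanguage with the same sorts and let $T$ be an $\mathcal L$-theory. Suppose that the reduct functor $$F:\mathrm{Mod}(T)\to \mathrm{Str}(\mathcal L'),\qquad F(\mathcal M)=\mathcal M\restriction\mathcal L',$$ is an equivalence of categories onto its image (that is, onto the full subcategory of $\mathrm{Str}(\mathcal L')$ on the $\mathcal L'$-structures isomorphic to some $F(\mathcal M)$). Then every $\mathcal L$-formula $\varphi(\bar x)$ is $T$-equivalent to an $\mathcal L'$-formula $\psi(\bar x)$: for every model $\mathcal M$ of $T$ and every tuple $\bar a$ from $\mathcal M$ sorted like $\bar x$, one has $\varphi^{\mathcal M}(\bar a)=\psi^{\mathcal M\restriction\mathcal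 L'}(\bar a)$. -/

import Mathlib

open CategoryTheory Topology

universe u

namespace ContLogic

/-- A uniform continuity modulus: an increasing, continuous `δ : [0,1] → [0,1]` with
`δ ε → 0` as `ε → 0⁺`, and `δ ε > 0` for `ε > 0`.  (Positivity is automatic if "increasing" is
read strictly; monotonicity is only required weakly here.) -/
structure Modulus where
  toFun : unitInterval → unitInterval
  mono : Monotone toFun
  cont : Continuous toFun
  tendsto_zero : Filter.Tendsto toFun (𝓝[>] 0) (𝓝 0)
  pos : ∀ ε, 0 < ε → 0 < toFun ε

/-- A (many-sorted) metric language.  The metric symbol of every sort is always present and is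
not listed among the relation symbols `Rel`.  Constants are function symbols of arity `0`. -/
structure Lang where
  /-- the sorts -/
  Srt : Type u
  /-- the bound on the diameter of each sort -/
  diamBound : Srt → ℝ
  diamBound_pos : ∀ S, 0 < diamBound S
  /-- the function symbols -/
  Fn : Type u
  fnArity : Fn → ℕ
  fnDom : ∀ f : Fn, Fin (fnArity f) → Srt
  fnCod : Fn → Srt
  fnMod : Fn → Modulus
  /-- the relation symbols other than the metrics -/
  Rel : Type u
  relArity : Rel → ℕ
  relDom : ∀ R : Rel, Fin (relArity R) → Srt
  relBound : Rel → ℝ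
  relBound_pos : ∀ R, 0 < relBound R
  relMod : Rel → Modulus

/-- A metric structure for the language `L`. -/
structure Struc (L : Lang.{u}) where
  carrier : L.Srt → Type u
  metric : ∀ S, MetricSpace (carrier S)
  complete : ∀ S, CompleteSpace (carrier S)
  nonempty : ∀ S, Nonempty (carrier S)
  dist_le : ∀ (S : L.Srt) (x y : carrier S), dist x y ≤ L.diamBound S
  fn : ∀ f : L.Fn, (∀ i, carrier (L.fnDom f i)) → carrier (L.fnCod f)
  fn_unif : ∀ (f : L.Fn) (ε : unitInterval), 0 < ε → ∀ a b : (∀ i, carrier (L.fnDom f i)),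
    (∀ i, dist (a i) (b i) < ((L.fnMod f).toFun ε : ℝ)) → dist (fn f a) (fn f b) ≤ (ε : ℝ)
  rel : ∀ R : L.Rel, (∀ i, carrier (L.relDom R i)) → ℝ
  rel_bound : ∀ (R : L.Rel) (a : ∀ i, carrier (L.relDom R i)), |rel R a| ≤ L.relBound R
  rel_unif : ∀ (R : L.Rel) (ε : unitInterval), 0 < ε → ∀ a b : (∀ i, carrier (L.relDom R i)),
    (∀ i, dist (a i) (b i) < ((L.relMod R).toFun ε : ℝ)) → |rel R a - rel R b| ≤ (ε : ℝ)

attribute [instance] Struc.metric Struc.complete Struc.nonempty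

/-- Tuples in `M` sorted like the tuple of variables `σ`. -/
abbrev Struc.Tuple {L : Lang.{u}} (M : Struc L) {n : ℕ} (σ : Fin n → L.Srt) : Type u :=
  ∀ i, M.carrier (σ i)

/-- The tuple `(b, a)`. -/
def Struc.consTuple {L : Lang.{u}} (M : Struc L) {n : ℕ} {σ : Fin n → L.Srt} {S : L.Srt}
    (b : M.carrier S) (a : M.Tuple σ) : M.Tuple (Fin.cons S σ : Fin (n + 1) → L.Srt) :=
  fun i => Fin.cases (motive := fun i => M.carrier ((Fin.cons S σ : Fin (n + 1) → L.Srt) i)) b a i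

/-- Terms in the variables `x₀, …, xₙ₋₁` of sorts `σ 0, …, σ (n-1)`, indexed by co-domain. -/
inductive Tm (L : Lang.{u}) {n : ℕ} (σ : Fin n → L.Srt) : L.Srt → Type u
  | var (i : Fin n) : Tm L σ (σ i)
  | app (f : L.Fn) (ts : ∀ i, Tm L σ (L.fnDom f i)) : Tm L σ (L.fnCod f)

/-- Basic formulas whose free variables are among `x₀, …, xₙ₋₁` of sorts `σ 0, …, σ (n-1)`:
atomic formulas, continuous connectives `ℝᵏ → ℝ`, and the quantifiers `sup` and `inf`, which
bind a variable of sort `S` put in front of the tuple. -/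
inductive BasicFormula (L : Lang.{u}) : {n : ℕ} → (Fin n → L.Srt) → Type u
  | metric {n : ℕ} {σ : Fin n → L.Srt} {S : L.Srt} (s t : Tm L σ S) : BasicFormula L σ
  | rel {n : ℕ} {σ : Fin n → L.Srt} (R : L.Rel) (ts : ∀ i, Tm L σ (L.relDom R i)) :
      BasicFormula L σ
  | conn {n : ℕ} {σ : Fin n → L.Srt} (k : ℕ) (f : C(Fin k → ℝ, ℝ))
      (φ : Fin k → BasicFormula L σ) : BasicFormula L σ
  | sup {n : ℕ} {σ : Fin n → L.Srt} (S : L.Srt)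
      (φ : BasicFormula L (Fin.cons S σ : Fin (n + 1) → L.Srt)) : BasicFormula L σ
  | inf {n : ℕ} {σ : Fin n → L.Srt} (S : L.Srt)
      (φ : BasicFormula L (Fin.cons S σ : Fin (n + 1) → L.Srt)) : BasicFormula L σ

/-- Interpretation of terms. -/
def Tm.eval {L : Lang.{u}} (M : Struc L) {n : ℕ} {σ : Fin n → L.Srt} (a : M.Tuple σ) :
    {S : L.Srt} → Tm L σ S → M.carrier S
  | _, .var i => a i
  | _, .app f ts => M.fn f (fun i => (ts i).eval M a)

/-- Interpretation of basic formulas. -/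
noncomputable def BasicFormula.eval {L : Lang.{u}} (M : Struc L) :
    {n : ℕ} → {σ : Fin n → L.Srt} → BasicFormula L σ → M.Tuple σ → ℝ
  | _, _, .metric s t, a => dist (s.eval M a) (t.eval M a)
  | _, _, .rel R ts, a => M.rel R (fun i => (ts i).eval M a)
  | _, _, .conn _ f φ, a => f (fun i => (φ i).eval M a)
  | _, _, .sup S φ, a => ⨆ b : M.carrier S, φ.eval M (M.consTuple b a)
  | _, _, .inf S φ, a => ⨅ b : M.carrier S, φ.eval M (M.consTuple b a)

/-- Every basic formula is bounded, uniformly over all structures. -/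
theorem BasicFormula.exists_bound {L : Lang.{u}} {n : ℕ} {σ : Fin n → L.Srt}
    (φ : BasicFormula L σ) :
    ∃ B : ℝ, ∀ (M : Struc L) (a : M.Tuple σ), |φ.eval M a| ≤ B := by
  induction φ with
  | @metric n σ S s t =>
    refine ⟨L.diamBound S, fun M a => ?_⟩
    simp only [BasicFormula.eval, abs_of_nonneg dist_nonneg]
    exact M.dist_le _ _ _
  | rel R ts => exact ⟨L.relBound R, fun M a => M.rel_bound R _⟩
  | conn k f φ ih =>
    choose B hB using ih
    have hK : IsCompact (Set.pi Set.univ fun i : Fin k => Set.Icc (-B i) (B i)) :=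
      isCompact_univ_pi fun i => isCompact_Icc
    obtain ⟨C, hC⟩ := hK.exists_bound_of_continuousOn f.continuous.continuousOn
    exact ⟨C, fun M a => hC _ fun i _ => abs_le.1 (hB i M a)⟩
  | sup S φ ih =>
    obtain ⟨B, hB⟩ := ih
    refine ⟨B, fun M a => ?_⟩
    simp only [BasicFormula.eval]
    obtain ⟨b⟩ := M.nonempty S
    refine abs_le.2 ⟨?_, ciSup_le fun b => (abs_le.1 (hB M _)).2⟩
    exact (abs_le.1 (hB M (M.consTuple b a))).1.trans
      (le_ciSup (f := fun b => φ.eval M (M.consTuple b a))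
        ⟨B, by rintro _ ⟨c, rfl⟩; exact (abs_le.1 (hB M _)).2⟩ b)
  | inf S φ ih =>
    obtain ⟨B, hB⟩ := ih
    refine ⟨B, fun M a => ?_⟩
    simp only [BasicFormula.eval]
    obtain ⟨b⟩ := M.nonempty S
    refine abs_le.2 ⟨le_ciInf fun b => (abs_le.1 (hB M _)).1, ?_⟩
    exact (ciInf_le (f := fun b => φ.eval M (M.consTuple b a))
      ⟨-B, by rintro _ ⟨c, rfl⟩; exact (abs_le.1 (hB M _)).1⟩ b).trans
        (abs_le.1 (hB M (M.consTuple b a))).2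

/-- Sentences: basic formulas without free variables. -/
abbrev Sentence (L : Lang.{u}) : Type u := BasicFormula L (n := 0) Fin.elim0

/-- The value of a sentence in a structure. -/
noncomputable def Sentence.value {L : Lang.{u}} (M : Struc L) (φ : Sentence L) : ℝ :=
  BasicFormula.eval M φ (fun i => i.elim0)

/-- A theory is a set of sentences. -/
abbrev Theory (L : Lang.{u}) : Type u := Set (Sentence L)

/-- `M` satisfies `T`: all sentences of `T` have value `0` in `M`. -/
def Struc.Satisfies {L : Lang.{u}} (M : Struc L) (T : Theory L) : Prop :=
  ∀ φ ∈ T, Sentence.value M φ = 0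

/-- Models of `T`; the objects of `Mod(T)`. -/
structure Mod {L : Lang.{u}} (T : Theory L) where
  struc : Struc L
  sat : struc.Satisfies T

/-- Elementary embeddings: families of maps between the sorts which commute with the function
symbols, preserve relations and metrics, and preserve the value of all basic formulas. -/
@[ext]
structure ElemEmb {L : Lang.{u}} (M N : Struc L) where
  toFun : ∀ S : L.Srt, M.carrier S → N.carrier S
  map_fn : ∀ (f : L.Fn) (a : M.Tuple (L.fnDom f)),
    toFun _ (M.fn f a) = N.fn f (fun i => toFun _ (a i))
  map_rel : ∀ (R : L.Rel) (a : M.Tuple (L.relDom R)),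
    N.rel R (fun i => toFun _ (a i)) = M.rel R a
  isometry : ∀ S : L.Srt, Isometry (toFun S)
  map_formula : ∀ {n : ℕ} {σ : Fin n → L.Srt} (φ : BasicFormula L σ) (a : M.Tuple σ),
    φ.eval N (fun i => toFun _ (a i)) = φ.eval M a

/-- The identity embedding. -/
def ElemEmb.id {L : Lang.{u}} (M : Struc L) : ElemEmb M M where
  toFun _ x := x
  map_fn _ _ := rfl
  map_rel _ _ := rfl
  isometry _ := isometry_id
  map_formula _ _ := rfl

/-- Composition of elementary embeddings. -/
def ElemEmb.comp {L : Lang.{u}} {M N P : Struc L} (g : ElemEmb M N) (h : ElemEmb N P) :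
    ElemEmb M P where
  toFun S x := h.toFun S (g.toFun S x)
  map_fn f a := by rw [g.map_fn, h.map_fn]
  map_rel R a := by rw [h.map_rel R (fun i => g.toFun _ (a i)), g.map_rel]
  isometry S := (h.isometry S).comp (g.isometry S)
  map_formula φ a := by rw [h.map_formula φ (fun i => g.toFun _ (a i)), g.map_formula]

/-- `Mod(T)`: models of `T` with elementary embeddings as morphisms. -/
instance {L : Lang.{u}} (T : Theory L) : Category.{u} (Mod T) where
  Hom M N := ElemEmb M.struc N.struc
  id M := ElemEmb.id M.struc
  comp g h := ElemEmb.comp g h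

/-- `Str(L)`: the category `Mod(T)` for the empty theory `T`. -/
abbrev Str (L : Lang.{u}) : Type (u + 1) := Mod (∅ : Theory L)

/-- A sublanguage `L' ⊆ L` with the same sorts: some of the function symbols and some of the
relation symbols of `L`, with all sorts of `L` (and hence their metric symbols and bounds). -/
structure Sublang (L : Lang.{u}) where
  fns : Set L.Fn
  rels : Set L.Rel

/-- A sublanguage as a language of its own; all data are inherited from `L`. -/
abbrev Sublang.lang {L : Lang.{u}} (L' : Sublang L) : Lang.{u} where
  Srt := L.Srt
  diamBound := L.diamBound
  diamBound_pos := L.diamBound_pos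
  Fn := L'.fns
  fnArity f := L.fnArity f.1
  fnDom f := L.fnDom f.1
  fnCod f := L.fnCod f.1
  fnMod f := L.fnMod f.1
  Rel := L'.rels
  relArity R := L.relArity R.1
  relDom R := L.relDom R.1
  relBound R := L.relBound R.1
  relBound_pos R := L.relBound_pos R.1
  relMod R := L.relMod R.1

/-- The reduct of an `L`-structure to a sublanguage. -/
abbrev Struc.reduct {L : Lang.{u}} (M : Struc L) (L' : Sublang L) : Struc L'.lang where
  carrier := M.carrier
  metric := M.metric
  complete := M.complete
  nonempty := M.nonempty
  dist_le := M.dist_le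
  fn f := M.fn f.1
  fn_unif f := M.fn_unif f.1
  rel R := M.rel R.1
  rel_bound R := M.rel_bound R.1
  rel_unif R := M.rel_unif R.1

/-- Terms of the sublanguage as terms of `L`. -/
def Tm.incl {L : Lang.{u}} {L' : Sublang L} {n : ℕ} {σ : Fin n → L.Srt} :
    {S : L.Srt} → Tm L'.lang σ S → Tm L σ S
  | _, .var i => .var i
  | _, .app f ts => .app f.1 (fun i => (ts i).incl)

/-- Basic formulas of the sublanguage as basic formulas of `L`. -/
def BasicFormula.incl {L : Lang.{u}} {L' : Sublang L} :
    {n : ℕ} → {σ : Fin n → L.Srt} → BasicFormula L'.lang σ → BasicFormula L σ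
  | _, _, .metric s t => .metric s.incl t.incl
  | _, _, .rel R ts => .rel R.1 (fun i => (ts i).incl)
  | _, _, .conn k f φ => .conn k f (fun i => (φ i).incl)
  | _, _, .sup S φ => .sup S φ.incl
  | _, _, .inf S φ => .inf S φ.incl

theorem Tm.eval_incl {L : Lang.{u}} {L' : Sublang L} (M : Struc L) {n : ℕ}
    {σ : Fin n → L.Srt} (a : M.Tuple σ) : {S : L.Srt} → (t : Tm L'.lang σ S) →
    Tm.eval M a (Tm.incl t) = Tm.eval (L := L'.lang) (M.reduct L') a t
  | _, .var _ => rfl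
  | _, .app f ts => congrArg (M.fn f.1) (funext fun i => Tm.eval_incl M a (ts i))

theorem BasicFormula.eval_incl {L : Lang.{u}} {L' : Sublang L} (M : Struc L) :
    {n : ℕ} → {σ : Fin n → L.Srt} → (φ : BasicFormula L'.lang σ) → (a : M.Tuple σ) →
    BasicFormula.eval M (BasicFormula.incl φ) a =
      BasicFormula.eval (L := L'.lang) (M.reduct L') φ a
  | _, _, .metric s t, a => congrArg₂ dist (Tm.eval_incl M a s) (Tm.eval_incl M a t)
  | _, _, .rel R ts, a => congrArg (M.rel R.1) (funext fun i => Tm.eval_incl M a (ts i))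
  | _, _, .conn _ f φ, a => congrArg f (funext fun i => BasicFormula.eval_incl M (φ i) a)
  | _, _, .sup _ φ, a => iSup_congr fun b => BasicFormula.eval_incl M φ (M.consTuple b a)
  | _, _, .inf _ φ, a => iInf_congr fun b => BasicFormula.eval_incl M φ (M.consTuple b a)

/-- The reduct of an elementary embedding. -/
def ElemEmb.reduct {L : Lang.{u}} {M N : Struc L} (g : ElemEmb M N) (L' : Sublang L) :
    ElemEmb (M.reduct L') (N.reduct L') where
  toFun := g.toFun
  map_fn f := g.map_fn f.1
  map_rel R := g.map_rel R.1
  isometry := g.isometry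
  map_formula φ a := by
    have h := g.map_formula φ.incl a
    rwa [BasicFormula.eval_incl, BasicFormula.eval_incl] at h

/-- The forgetful functor `Mod(T) ⥤ Str(L')`, `M ↦ M ↾ L'`. -/
def reductFunctor {L : Lang.{u}} (T : Theory L) (L' : Sublang L) : Mod T ⥤ Str L'.lang where
  obj M := ⟨M.struc.reduct L', fun _ h => h.elim⟩
  map g := ElemEmb.reduct g L'

/-- Basic formulas in the variables `σ`, to be equipped with the pseudometric of `T`. -/
def PreForm {L : Lang.{u}} (_T : Theory L) {n : ℕ} (σ : Fin n → L.Srt) : Type u :=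
  BasicFormula L σ

/-- `‖φ - ψ‖_T`, the supremum of `|φ^M(a) - ψ^M(a)|` over all models `M` of `T` and all `a`. -/
noncomputable def distT {L : Lang.{u}} (T : Theory L) {n : ℕ} {σ : Fin n → L.Srt}
    (φ ψ : BasicFormula L σ) : ℝ :=
  ⨆ p : (Σ M : Mod T, M.struc.Tuple σ), |φ.eval p.1.struc p.2 - ψ.eval p.1.struc p.2|

theorem abs_sub_le_distT {L : Lang.{u}} {T : Theory L} {n : ℕ} {σ : Fin n → L.Srt}
    (φ ψ : BasicFormula L σ) (M : Mod T) (a : M.struc.Tuple σ) :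
    |φ.eval M.struc a - ψ.eval M.struc a| ≤ distT T φ ψ := by
  obtain ⟨B, hB⟩ := φ.exists_bound
  obtain ⟨C, hC⟩ := ψ.exists_bound
  refine le_ciSup (f := fun p : (Σ M : Mod T, M.struc.Tuple σ) =>
    |φ.eval p.1.struc p.2 - ψ.eval p.1.struc p.2|) ⟨B + C, ?_⟩ ⟨M, a⟩
  rintro _ ⟨p, rfl⟩
  exact (abs_sub _ _).trans (add_le_add (hB _ _) (hC _ _))

/-- The pseudometric `‖φ - ψ‖_T` on basic formulas. -/
noncomputable instance {L : Lang.{u}} (T : Theory L) {n : ℕ} (σ : Fin n → L.Srt) :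
    PseudoMetricSpace (PreForm T σ) where
  dist φ ψ := distT T φ ψ
  dist_self φ := by simp [distT]
  dist_comm φ ψ := by simp only [distT, abs_sub_comm]
  dist_triangle φ ψ χ := by
    refine Real.iSup_le (fun p => ?_) ?_
    · exact (abs_sub_le _ (BasicFormula.eval p.1.struc ψ p.2) _).trans
        (add_le_add (abs_sub_le_distT φ ψ p.1 p.2) (abs_sub_le_distT ψ χ p.1 p.2))
    · exact add_nonneg (Real.iSup_nonneg fun _ => abs_nonneg _)
        (Real.iSup_nonneg fun _ => abs_nonneg _)

/-- `Form_σ(T, L)`: the `T`-formulas in the variables `σ`, i.e. the (Hausdorff) completion of the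
basic formulas with respect to `‖·‖_T`. -/
abbrev Form {L : Lang.{u}} (T : Theory L) {n : ℕ} (σ : Fin n → L.Srt) : Type u :=
  UniformSpace.Completion (PreForm T σ)

/-- The interpretation of a `T`-formula in a model of `T`: the continuous extension of the
interpretation of basic formulas. -/
noncomputable def Form.eval {L : Lang.{u}} {T : Theory L} {n : ℕ} {σ : Fin n → L.Srt}
    (M : Mod T) (φ : Form T σ) (a : M.struc.Tuple σ) : ℝ :=
  UniformSpace.Completion.extension
    (fun ψ : PreForm T σ => BasicFormula.eval M.struc ψ a) φ

theorem uniformContinuous_eval {L : Lang.{u}} {T : Theory L} {n : ℕ} {σ : Fin n → L.Srt}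
    (M : Mod T) (a : M.struc.Tuple σ) :
    UniformContinuous (fun ψ : PreForm T σ => BasicFormula.eval M.struc ψ a) :=
  (LipschitzWith.of_dist_le_mul (K := 1) fun φ ψ => by
    rw [Real.dist_eq, NNReal.coe_one, one_mul]
    exact abs_sub_le_distT φ ψ M a).uniformContinuous

theorem Form.eval_coe {L : Lang.{u}} {T : Theory L} {n : ℕ} {σ : Fin n → L.Srt}
    (M : Mod T) (φ : PreForm T σ) (a : M.struc.Tuple σ) :
    Form.eval M (φ : Form T σ) a = BasicFormula.eval M.struc φ a :=
  UniformSpace.Completion.extension_coe (uniformContinuous_eval M a) φ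

/-- `L`-formulas: `T`-formulas for the empty theory. -/
abbrev Formula (L : Lang.{u}) {n : ℕ} (σ : Fin n → L.Srt) : Type u :=
  Form (∅ : Theory L) σ

/-- Any `L`-structure as an object of `Str(L)`. -/
def Struc.toStr {L : Lang.{u}} (M : Struc L) : Str L := ⟨M, fun _ h => h.elim⟩

/-- The `L`-formula `φ` and the `L'`-formula `ψ` are `T`-equivalent: they have the same value at
all tuples of all models of `T` (i.e. `‖φ - ψ‖_T = 0`), where `L'`-formulas are interpreted in an
`L`-structure through its reduct. -/
def TEquiv {L : Lang.{u}} (T : Theory L) {L' : Sublang L} {n : ℕ} {σ : Fin n → L.Srt}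
    (φ : Formula L σ) (ψ : Formula L'.lang σ) : Prop :=
  ∀ (M : Struc L), M.Satisfies T → ∀ a : M.Tuple σ,
    Form.eval M.toStr φ a = Form.eval (M.reduct L').toStr ψ a

end ContLogic

/-! An equivalence onto the essential image is full, and fullness drives the argument. Let `a` in
`M` and `b` in `N`, both models of `T`, have the same `L'`-type. Then the `L'`-reduct of `M` embeds
elementarily into an ultrapower of the reduct of `N`, with `a` sent to the diagonal image of `b`
(`exists_elemEmb_ultraprod`). That ultrapower is the reduct of an ultrapower of `N`, which is a
model of `T` by Łoś's theorem, so fullness lifts the embedding to an `L`-elementary one. Hence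
`L'`-types determine the values of all basic `L`-formulas (`eval_eq_of_full`).

Compactness, again by ultraproducts, makes this uniform: up to `ε`, a basic `φ` depends only on
finitely many basic `L'`-formulas known up to some `δ` (`exists_finset_of_full`). Extending this
dependence to a continuous connective gives a basic `L'`-formula within `ε` of `φ` on models of `T`
(`exists_basicFormula_approx`).

Such approximations converge uniformly only on models of `T`, whereas an `L'`-formula is a limit
that is uniform over all `L'`-structures. Truncating the successive increments (`forcedSeq`) forces
convergence everywhere and changes nothing on reducts of models of `T`. -/

namespace ContLogic

/-! ### Substitution in terms and formulas -/

/-- Terms with a dummy variable put in front of the tuple. -/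
def Tm.shift {L : Lang.{u}} {n : ℕ} {σ : Fin n → L.Srt} (S' : L.Srt) :
    {S : L.Srt} → Tm L σ S → Tm L (Fin.cons S' σ : Fin (n + 1) → L.Srt) S
  | _, .var i => Tm.var (σ := (Fin.cons S' σ : Fin (n + 1) → L.Srt)) i.succ
  | _, .app f ts => .app f (fun i => (ts i).shift S')

theorem Tm.eval_shift {L : Lang.{u}} (M : Struc L) {n : ℕ} {σ : Fin n → L.Srt} {S' : L.Srt}
    (b : M.carrier S') (a : M.Tuple σ) : {S : L.Srt} → (t : Tm L σ S) →
    (t.shift S').eval M (M.consTuple b a) = t.eval M a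
  | _, .var _ => rfl
  | _, .app f ts => congrArg (M.fn f) (funext fun i => Tm.eval_shift M b a (ts i))

/-- Simultaneous substitution in terms. -/
def Tm.subst {L : Lang.{u}} {n m : ℕ} {σ : Fin n → L.Srt} {τ : Fin m → L.Srt}
    (ρ : ∀ i, Tm L τ (σ i)) : {S : L.Srt} → Tm L σ S → Tm L τ S
  | _, .var i => ρ i
  | _, .app f ts => .app f (fun i => (ts i).subst ρ)

theorem Tm.eval_subst {L : Lang.{u}} (M : Struc L) {n m : ℕ} {σ : Fin n → L.Srt}
    {τ : Fin m → L.Srt} (ρ : ∀ i, Tm L τ (σ i)) (a : M.Tuple τ) : {S : L.Srt} →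
    (t : Tm L σ S) → (t.subst ρ).eval M a = t.eval M (fun i => (ρ i).eval M a)
  | _, .var _ => rfl
  | _, .app f ts => congrArg (M.fn f) (funext fun i => Tm.eval_subst M ρ a (ts i))

/-- A substitution extended by a bound variable. -/
def liftSubst {L : Lang.{u}} {n m : ℕ} {σ : Fin n → L.Srt} {τ : Fin m → L.Srt}
    (S : L.Srt) (ρ : ∀ i, Tm L τ (σ i)) (i : Fin (n + 1)) :
    Tm L (Fin.cons S τ : Fin (m + 1) → L.Srt) ((Fin.cons S σ : Fin (n + 1) → L.Srt) i) :=
  Fin.cases (motive := fun i => Tm L (Fin.cons S τ : Fin (m + 1) → L.Srt)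
      ((Fin.cons S σ : Fin (n + 1) → L.Srt) i))
    (Tm.var (σ := (Fin.cons S τ : Fin (m + 1) → L.Srt)) 0) (fun i => (ρ i).shift S) i

theorem eval_liftSubst {L : Lang.{u}} (M : Struc L) {n m : ℕ} {σ : Fin n → L.Srt}
    {τ : Fin m → L.Srt} {S : L.Srt} (ρ : ∀ i, Tm L τ (σ i)) (b : M.carrier S) (a : M.Tuple τ) :
    (fun i => (liftSubst S ρ i).eval M (M.consTuple b a)) =
      M.consTuple b (fun i => (ρ i).eval M a) := by
  funext i
  refine Fin.cases ?_ (fun i => ?_) i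
  · rfl
  · exact Tm.eval_shift M b a (ρ i)

/-- Simultaneous substitution in basic formulas. -/
def BasicFormula.subst {L : Lang.{u}} : {n m : ℕ} → {σ : Fin n → L.Srt} → {τ : Fin m → L.Srt} →
    (∀ i, Tm L τ (σ i)) → BasicFormula L σ → BasicFormula L τ
  | _, _, _, _, ρ, .metric s t => .metric (s.subst ρ) (t.subst ρ)
  | _, _, _, _, ρ, .rel R ts => .rel R (fun i => (ts i).subst ρ)
  | _, _, _, _, ρ, .conn k f φ => .conn k f (fun i => (φ i).subst ρ)
  | _, _, _, _, ρ, .sup S φ => .sup S (φ.subst (liftSubst S ρ))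
  | _, _, _, _, ρ, .inf S φ => .inf S (φ.subst (liftSubst S ρ))

theorem BasicFormula.eval_subst {L : Lang.{u}} (M : Struc L) : {n m : ℕ} → {σ : Fin n → L.Srt} →
    {τ : Fin m → L.Srt} → (ρ : ∀ i, Tm L τ (σ i)) → (φ : BasicFormula L σ) → (a : M.Tuple τ) →
    (φ.subst ρ).eval M a = φ.eval M (fun i => (ρ i).eval M a)
  | _, _, _, _, ρ, .metric s t, a =>
    congrArg₂ dist (Tm.eval_subst M ρ a s) (Tm.eval_subst M ρ a t)
  | _, _, _, _, ρ, .rel R ts, a => congrArg (M.rel R) (funext fun i => Tm.eval_subst M ρ a (ts i))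
  | _, _, _, _, ρ, .conn _ f φ, a =>
    congrArg f (funext fun i => BasicFormula.eval_subst M ρ (φ i) a)
  | _, _, _, _, ρ, .sup S φ, a => iSup_congr fun b =>
    (BasicFormula.eval_subst M (liftSubst S ρ) φ (M.consTuple b a)).trans
      (congrArg (φ.eval M) (eval_liftSubst M ρ b a))
  | _, _, _, _, ρ, .inf S φ, a => iInf_congr fun b =>
    (BasicFormula.eval_subst M (liftSubst S ρ) φ (M.consTuple b a)).trans
      (congrArg (φ.eval M) (eval_liftSubst M ρ b a))

/-- Maps which preserve the value of all basic formulas are elementary embeddings. -/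
def ElemEmb.ofMapFormula {L : Lang.{u}} {M N : Struc L}
    (h : ∀ S : L.Srt, M.carrier S → N.carrier S)
    (hh : ∀ {n : ℕ} {σ : Fin n → L.Srt} (φ : BasicFormula L σ) (a : M.Tuple σ),
      φ.eval N (fun i => h _ (a i)) = φ.eval M a) : ElemEmb M N where
  toFun := h
  map_formula := hh
  map_rel R a := hh (.rel R fun i => .var i) a
  map_fn f a := by
    -- The formula `d(y, f(x))` vanishes at `(f(a), a)`, hence also at the image tuple.
    have key := hh (.metric (Tm.var (σ := (Fin.cons (L.fnCod f) (L.fnDom f) :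
      Fin (L.fnArity f + 1) → L.Srt)) 0)
      (.app f fun i => (Tm.var (σ := L.fnDom f) i).shift (L.fnCod f))) (M.consTuple (M.fn f a) a)
    refine dist_eq_zero.1 (key.trans ?_)
    exact dist_self (M.fn f a)
  isometry S := Isometry.of_dist_eq fun x y =>
    hh (.metric (Tm.var (σ := fun _ : Fin 2 => S) 0) (Tm.var (σ := fun _ : Fin 2 => S) 1))
      (fun i => if i = 0 then x else y)

/-! ### Metric ultraproducts and Łoś's theorem -/

theorem exists_tendsto_ultrafilter_of_bounded {I : Type*} (U : Ultrafilter I) {f : I → ℝ} {B : ℝ}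
    (hf : ∀ i, |f i| ≤ B) : ∃ x, Filter.Tendsto f U (𝓝 x) := by
  obtain ⟨x, -, hx⟩ := isCompact_iff_ultrafilter_le_nhds'.1 (isCompact_Icc (a := -B) (b := B))
    (U.map f) (Filter.Eventually.of_forall (f := (U : Filter I)) fun i => abs_le.1 (hf i))
  exact ⟨x, hx⟩

section Ultraproduct

variable {L : Lang.{u}} {I : Type u} (M : I → Struc L) (U : Ultrafilter I)

/-- Families of elements of sort `S`, with the pseudometric given by the limit along `U`. -/
def PreUltraprod (_U : Ultrafilter I) (S : L.Srt) : Type u := ∀ i, (M i).carrier S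

/-- The limit of the distances along the ultrafilter. -/
noncomputable instance (S : L.Srt) : Dist (PreUltraprod M U S) where
  dist x y := Filter.limUnder (U : Filter I) fun i => dist (x i) (y i)

theorem PreUltraprod.tendsto_dist {S : L.Srt} (x y : PreUltraprod M U S) :
    Filter.Tendsto (fun i => dist (x i) (y i)) U (𝓝 (dist x y)) :=
  tendsto_nhds_limUnder (exists_tendsto_ultrafilter_of_bounded U (B := L.diamBound S) fun i => by
    rw [abs_of_nonneg dist_nonneg]
    exact (M i).dist_le S _ _)

noncomputable instance (S : L.Srt) : PseudoMetricSpace (PreUltraprod M U S) where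
  dist_self x := by
    refine tendsto_nhds_unique (PreUltraprod.tendsto_dist M U x x) ?_
    simp only [dist_self]
    exact tendsto_const_nhds
  dist_comm x y := by
    refine tendsto_nhds_unique (PreUltraprod.tendsto_dist M U x y) ?_
    simp only [dist_comm (x _)]
    exact PreUltraprod.tendsto_dist M U y x
  dist_triangle x y z :=
    le_of_tendsto_of_tendsto' (PreUltraprod.tendsto_dist M U x z)
      ((PreUltraprod.tendsto_dist M U x y).add (PreUltraprod.tendsto_dist M U y z))
      fun _ => dist_triangle _ _ _

open Classical in
/-- Representatives of a fast Cauchy sequence in the ultraproduct, changed so that all the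
coordinate sequences are fast Cauchy sequences. -/
noncomputable def PreUltraprod.adjust {S : L.Srt} (x : ℕ → PreUltraprod M U S) :
    ℕ → PreUltraprod M U S
  | 0 => x 0
  | k + 1 => fun i => if dist (adjust x k i) (x (k + 1) i) ≤ 1 / 2 / 2 ^ k then x (k + 1) i
      else adjust x k i

theorem PreUltraprod.dist_adjust_succ_le {S : L.Srt} (x : ℕ → PreUltraprod M U S) (k : ℕ) (i : I) :
    dist (adjust M U x k i) (adjust M U x (k + 1) i) ≤ 1 / 2 / 2 ^ k := by
  rw [adjust]
  beta_reduce
  split_ifs with h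
  · exact h
  · rw [dist_self]
    positivity

/-- Inductively, the adjusted `k`-th term has limit distance less than `1 / 2 / 2 ^ k` from `x (k +
1)`. As the inequality is strict, it holds in `U`-almost all coordinates, and there the adjustment
simply takes `x (k + 1)`. -/
theorem PreUltraprod.dist_adjust_eq_zero {S : L.Srt} {x : ℕ → PreUltraprod M U S}
    (hx : ∀ k, dist (x k) (x (k + 1)) < 1 / 2 / 2 ^ k) (k : ℕ) :
    dist (adjust M U x k) (x k) = 0 := by
  induction k with
  | zero => exact dist_self _
  | succ k ih =>
    have h1 : dist (adjust M U x k) (x (k + 1)) < 1 / 2 / 2 ^ k :=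
      ((dist_triangle _ (x k) _).trans_eq (by rw [ih, zero_add])).trans_lt (hx k)
    refine tendsto_nhds_unique (tendsto_dist M U _ _) (tendsto_const_nhds.congr' ?_)
    filter_upwards [(tendsto_dist M U _ _).eventually_lt_const h1] with i hi
    rw [adjust]
    beta_reduce
    rw [if_pos hi.le, dist_self]

/-- After adjustment, a limit can be taken in each complete space `M i` separately. The geometric
tail bound is uniform in `i`, so it passes to the limit along `U`. No countable incompleteness of
`U` is needed. -/
instance (S : L.Srt) : CompleteSpace (PreUltraprod M U S) := by
  refine Metric.complete_of_convergent_controlled_sequences (fun k => 1 / 2 / 2 ^ k)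
    (fun k => by positivity) fun x hx => ?_
  have hx' : ∀ k, dist (x k) (x (k + 1)) < 1 / 2 / 2 ^ k := fun k => hx k k (k + 1) le_rfl k.le_succ
  have hlim : ∀ i, ∃ y, Filter.Tendsto (fun k => PreUltraprod.adjust M U x k i) Filter.atTop (𝓝 y) :=
    fun i => cauchySeq_tendsto_of_complete
      (cauchySeq_of_le_geometric_two fun k => PreUltraprod.dist_adjust_succ_le M U x k i)
  choose y hy using hlim
  refine ⟨y, tendsto_iff_dist_tendsto_zero.2 ?_⟩
  have hle : ∀ k, dist (x k) (y : PreUltraprod M U S) ≤ 1 / 2 ^ k := fun k => by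
    have h0 : dist (PreUltraprod.adjust M U x k) (y : PreUltraprod M U S) ≤ 1 / 2 ^ k :=
      le_of_tendsto' (PreUltraprod.tendsto_dist M U _ _) fun i =>
        dist_le_of_le_geometric_two_of_tendsto
          (fun k => PreUltraprod.dist_adjust_succ_le M U x k i) (hy i) k
    refine (dist_triangle_left _ _ (PreUltraprod.adjust M U x k)).trans ?_
    rwa [PreUltraprod.dist_adjust_eq_zero M U hx', zero_add]
  refine squeeze_zero (fun _ => dist_nonneg) hle ?_
  simpa using tendsto_pow_atTop_nhds_zero_of_lt_one (r := (1 / 2 : ℝ)) (by norm_num) (by norm_num)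

/-- The carrier of sort `S` of the ultraproduct. -/
abbrev UltraCarrier (S : L.Srt) : Type u := SeparationQuotient (PreUltraprod M U S)

/-- The class of a family. -/
noncomputable def ultraMk {S : L.Srt} (x : ∀ i, (M i).carrier S) : UltraCarrier M U S :=
  SeparationQuotient.mk (x : PreUltraprod M U S)

/-- A representative of an element of the ultraproduct. -/
noncomputable def ultraOut {S : L.Srt} (x : UltraCarrier M U S) : ∀ i, (M i).carrier S :=
  Function.surjInv (SeparationQuotient.surjective_mk (X := PreUltraprod M U S)) x

theorem ultraMk_out {S : L.Srt} (x : UltraCarrier M U S) : ultraMk M U (ultraOut M U x) = x :=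
  Function.surjInv_eq _ x

theorem tendsto_dist_ultraMk {S : L.Srt} (x y : ∀ i, (M i).carrier S) :
    Filter.Tendsto (fun i => dist (x i) (y i)) U (𝓝 (dist (ultraMk M U x) (ultraMk M U y))) :=
  PreUltraprod.tendsto_dist M U x y

theorem tendsto_dist_ultraOut {S : L.Srt} (x y : UltraCarrier M U S) :
    Filter.Tendsto (fun i => dist (ultraOut M U x i) (ultraOut M U y i)) U (𝓝 (dist x y)) := by
  have h := tendsto_dist_ultraMk M U (ultraOut M U x) (ultraOut M U y)
  rwa [ultraMk_out, ultraMk_out] at h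

/-- Families of operations which share a uniform continuity modulus are compatible with limits
along `U`. -/
theorem Modulus.tendsto_zero_of_unif {I : Type*} {U : Ultrafilter I} (δ : Modulus) {k : ℕ}
    {d : Fin k → I → ℝ} (hd : ∀ j, Filter.Tendsto (d j) U (𝓝 0)) {e : I → ℝ} (he : ∀ i, 0 ≤ e i)
    (h : ∀ ε : unitInterval, 0 < ε → ∀ i, (∀ j, d j i < (δ.toFun ε : ℝ)) → e i ≤ (ε : ℝ)) :
    Filter.Tendsto e U (𝓝 0) := by
  refine Metric.tendsto_nhds.2 fun r hr => ?_
  -- Staying below `1` puts `s` in the domain of the modulus; staying strictly below `r` turns the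
  -- weak bound of `h` into a strict one.
  obtain ⟨s, hs0, hs⟩ := exists_between (lt_min hr one_pos)
  have hs1 : s < 1 := hs.trans_le (min_le_right _ _)
  have hev := Filter.eventually_all.2 fun j => (hd j).eventually_lt_const
    (u := (δ.toFun ⟨s, hs0.le, hs1.le⟩ : ℝ)) (δ.pos _ hs0)
  filter_upwards [hev] with i hi
  rw [Real.dist_0_eq_abs, abs_of_nonneg (he i)]
  exact (h ⟨s, hs0.le, hs1.le⟩ hs0 i hi).trans_lt (hs.trans_le (min_le_left _ _))

/-- The value of a relation symbol in the ultraproduct. -/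
noncomputable def ultraRel (R : L.Rel) (a : ∀ j, UltraCarrier M U (L.relDom R j)) : ℝ :=
  Filter.limUnder (U : Filter I) fun i => (M i).rel R fun j => ultraOut M U (a j) i

theorem tendsto_ultraRel (R : L.Rel) (a : ∀ j, UltraCarrier M U (L.relDom R j)) :
    Filter.Tendsto (fun i => (M i).rel R fun j => ultraOut M U (a j) i) U
      (𝓝 (ultraRel M U R a)) :=
  tendsto_nhds_limUnder (exists_tendsto_ultrafilter_of_bounded U fun i => (M i).rel_bound R _)

/-- The ultraproduct of a family of structures. -/
noncomputable def ultraprod : Struc L where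
  carrier := UltraCarrier M U
  metric _ := inferInstance
  complete _ := inferInstance
  nonempty S := ⟨ultraMk M U fun i => ((M i).nonempty S).some⟩
  dist_le S x y := le_of_tendsto' (tendsto_dist_ultraOut M U x y) fun i => (M i).dist_le S _ _
  fn f a := ultraMk M U fun i => (M i).fn f fun j => ultraOut M U (a j) i
  fn_unif f ε hε a b hab := by
    refine le_of_tendsto (tendsto_dist_ultraMk M U _ _) ?_
    filter_upwards [Filter.eventually_all.2 fun j =>
      (tendsto_dist_ultraOut M U (a j) (b j)).eventually_lt_const (hab j)] with i hi
    exact (M i).fn_unif f ε hε _ _ hi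
  rel := ultraRel M U
  rel_bound R a := le_of_tendsto' (tendsto_ultraRel M U R a).abs fun i => (M i).rel_bound R _
  rel_unif R ε hε a b hab := by
    refine le_of_tendsto ((tendsto_ultraRel M U R a).sub (tendsto_ultraRel M U R b)).abs ?_
    filter_upwards [Filter.eventually_all.2 fun j =>
      (tendsto_dist_ultraOut M U (a j) (b j)).eventually_lt_const (hab j)] with i hi
    exact (M i).rel_unif R ε hε _ _ hi

theorem tendsto_dist_out_mk {S : L.Srt} (x : ∀ i, (M i).carrier S) :
    Filter.Tendsto (fun i => dist (ultraOut M U (ultraMk M U x) i) (x i)) U (𝓝 0) := by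
  have h := tendsto_dist_ultraMk M U (ultraOut M U (ultraMk M U x)) x
  rwa [ultraMk_out, dist_self] at h

/-- Symbols of the ultraproduct are defined through chosen representatives. Other representatives
have limit distance zero from the chosen ones, and the common modulus makes the values agree in the
limit. -/
theorem ultraprod_fn (f : L.Fn) (a : ∀ i, (M i).Tuple (L.fnDom f)) :
    (ultraprod M U).fn f (fun j => ultraMk M U fun i => a i j) =
      ultraMk M U fun i => (M i).fn f (a i) :=
  dist_eq_zero.1 <| tendsto_nhds_unique (tendsto_dist_ultraMk M U _ _) <|
    (L.fnMod f).tendsto_zero_of_unif (fun j => tendsto_dist_out_mk M U fun i => a i j)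
      (fun _ => dist_nonneg) fun ε hε i => (M i).fn_unif f ε hε _ _

theorem tendsto_ultraprod_rel (R : L.Rel) (a : ∀ i, (M i).Tuple (L.relDom R)) :
    Filter.Tendsto (fun i => (M i).rel R (a i)) U
      (𝓝 ((ultraprod M U).rel R fun j => ultraMk M U fun i => a i j)) := by
  have h0 := (L.relMod R).tendsto_zero_of_unif
    (fun j => tendsto_dist_out_mk M U fun i => a i j)
    (fun _ => abs_nonneg _) fun ε hε i => (M i).rel_unif R ε hε _ (a i)
  have h1 := (tendsto_ultraRel M U R fun j => ultraMk M U fun i => a i j).sub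
    (tendsto_zero_iff_abs_tendsto_zero _ |>.2 h0)
  refine (sub_zero (ultraRel M U R _) ▸ h1).congr fun i => ?_
  exact sub_sub_cancel _ _

theorem eval_ultraMk {n : ℕ} {σ : Fin n → L.Srt} (a : ∀ i, (M i).Tuple σ) : {S : L.Srt} →
    (t : Tm L σ S) →
    t.eval (ultraprod M U) (fun j => ultraMk M U fun i => a i j) =
      ultraMk M U fun i => t.eval (M i) (a i)
  | _, .var _ => rfl
  | _, .app f ts => (congrArg ((ultraprod M U).fn f) (funext fun j => eval_ultraMk a (ts j))).trans
      (ultraprod_fn M U f fun i j => (ts j).eval (M i) (a i))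

theorem consTuple_ultraMk {n : ℕ} {σ : Fin n → L.Srt} {S : L.Srt} (b : ∀ i, (M i).carrier S)
    (a : ∀ i, (M i).Tuple σ) :
    (ultraprod M U).consTuple (σ := σ) (ultraMk M U b) (fun j => ultraMk M U fun i => a i j) =
      fun j => ultraMk M U fun i => (M i).consTuple (b i) (a i) j := by
  funext j
  exact Fin.cases rfl (fun _ => rfl) j

theorem bddAbove_eval {M : Struc L} {n : ℕ} {σ : Fin n → L.Srt} {S : L.Srt}
    (φ : BasicFormula L (Fin.cons S σ : Fin (n + 1) → L.Srt)) (a : M.Tuple σ) :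
    BddAbove (Set.range fun b => φ.eval M (M.consTuple b a)) := by
  obtain ⟨B, hB⟩ := φ.exists_bound
  exact ⟨B, by rintro _ ⟨c, rfl⟩; exact (abs_le.1 (hB M _)).2⟩

theorem bddBelow_eval {M : Struc L} {n : ℕ} {σ : Fin n → L.Srt} {S : L.Srt}
    (φ : BasicFormula L (Fin.cons S σ : Fin (n + 1) → L.Srt)) (a : M.Tuple σ) :
    BddBelow (Set.range fun b => φ.eval M (M.consTuple b a)) := by
  obtain ⟨B, hB⟩ := φ.exists_bound
  exact ⟨-B, by rintro _ ⟨c, rfl⟩; exact (abs_le.1 (hB M _)).1⟩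

/-- **Łoś's theorem** for metric ultraproducts. -/
theorem tendsto_eval_ultraprod {n : ℕ} {σ : Fin n → L.Srt} (φ : BasicFormula L σ)
    (a : ∀ i, (M i).Tuple σ) :
    Filter.Tendsto (fun i => φ.eval (M i) (a i)) U
      (𝓝 (φ.eval (ultraprod M U) fun j => ultraMk M U fun i => a i j)) := by
  induction φ with
  | metric s t =>
    simp only [BasicFormula.eval, eval_ultraMk]
    exact tendsto_dist_ultraMk M U _ _
  | rel R ts =>
    simp only [BasicFormula.eval, eval_ultraMk]
    exact tendsto_ultraprod_rel M U R fun i j => (ts j).eval (M i) (a i)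
  | conn k f φ ih =>
    exact (f.continuous.tendsto _).comp (tendsto_pi_nhds.2 fun j => ih j a)
  | @sup n σ S φ ih =>
    -- Boundedness provides some limit `x`; it remains to identify it with the supremum in the
    -- ultraproduct.
    obtain ⟨x, hx⟩ := exists_tendsto_ultrafilter_of_bounded U
      fun i => (BasicFormula.sup S φ).exists_bound.choose_spec (M i) (a i)
    convert hx using 2
    refine le_antisymm ((ciSup_le fun b => ?_)) (le_of_forall_pos_le_add fun ε hε => ?_)
    · rw [← ultraMk_out M U b, consTuple_ultraMk]
      exact le_of_tendsto_of_tendsto' (ih fun i => (M i).consTuple (ultraOut M U b i) (a i)) hx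
        fun i => le_ciSup (bddAbove_eval φ (a i)) (ultraOut M U b i)
    -- Witnesses within `ε` of the supremum are chosen in every coordinate; their class is a witness
    -- in the ultraproduct.
    · have hb : ∀ i, ∃ b, (BasicFormula.sup S φ).eval (M i) (a i) - ε <
          φ.eval (M i) ((M i).consTuple b (a i)) := fun i =>
        exists_lt_of_lt_ciSup (sub_lt_self _ hε)
      choose b hb using hb
      refine le_of_tendsto_of_tendsto' hx
        ((ih fun i => (M i).consTuple (b i) (a i)).add_const ε) (fun i => ?_) |>.trans
        (add_le_add_left ?_ ε)
      · exact (sub_lt_iff_lt_add.1 (hb i)).le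
      · rw [← consTuple_ultraMk]
        exact le_ciSup (bddAbove_eval (M := ultraprod M U) φ _) (ultraMk M U b)
  | @inf n σ S φ ih =>
    obtain ⟨x, hx⟩ := exists_tendsto_ultrafilter_of_bounded U
      fun i => (BasicFormula.inf S φ).exists_bound.choose_spec (M i) (a i)
    convert hx using 2
    refine le_antisymm (le_of_forall_pos_le_add fun ε hε => ?_) ((le_ciInf fun b => ?_))
    · have hb : ∀ i, ∃ b, φ.eval (M i) ((M i).consTuple b (a i)) <
          (BasicFormula.inf S φ).eval (M i) (a i) + ε := fun i =>
        exists_lt_of_ciInf_lt (lt_add_of_pos_right _ hε)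
      choose b hb using hb
      refine le_trans ?_ (le_of_tendsto_of_tendsto' (ih fun i => (M i).consTuple (b i) (a i))
        (hx.add_const ε) (fun i => (hb i).le))
      rw [← consTuple_ultraMk]
      exact ciInf_le (bddBelow_eval (M := ultraprod M U) φ _) (ultraMk M U b)
    · rw [← ultraMk_out M U b, consTuple_ultraMk]
      exact le_of_tendsto_of_tendsto' hx (ih fun i => (M i).consTuple (ultraOut M U b i) (a i))
        fun i => ciInf_le (bddBelow_eval φ (a i)) (ultraOut M U b i)

/-- An ultraproduct of models of `T` is a model of `T`. -/
theorem ultraprod_satisfies {T : Theory L} (hM : ∀ i, (M i).Satisfies T) :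
    (ultraprod M U).Satisfies T := fun φ hφ => by
  have h := tendsto_eval_ultraprod M U φ fun _ j => j.elim0
  have h0 : ∀ i, φ.eval (M i) (fun j => j.elim0) = 0 := fun i => hM i φ hφ
  simp only [h0] at h
  refine Eq.trans ?_ (tendsto_nhds_unique h tendsto_const_nhds)
  exact congrArg (φ.eval (ultraprod M U)) (funext fun j => j.elim0)

end Ultraproduct

/-! ### Elementary embeddings into ultrapowers -/

section Approximation

variable {K : Lang.{u}} {M N : Struc K} {n : ℕ} {σ : Fin n → K.Srt} {a : M.Tuple σ} {b : N.Tuple σ}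

/-- A finite tuple from `M` extending `a` and containing `E` such that its type is finitely
satisfiable in `N` by tuples extending `b`, when `a` and `b` have the same type. -/
theorem exists_context (hab : ∀ ψ : BasicFormula K σ, ψ.eval M a = ψ.eval N b)
    (E : Finset (Σ S, M.carrier S)) :
    ∃ (k : ℕ) (τ : Fin k → K.Srt) (e : M.Tuple τ) (s : ∀ j, Tm K τ (σ j)),
      (∀ j, (s j).eval M e = a j) ∧ (∀ d ∈ E, ∃ t : Tm K τ d.1, t.eval M e = d.2) ∧
      ∀ (χ : BasicFormula K τ) (ε : ℝ), 0 < ε → ∃ e' : N.Tuple τ,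
        (∀ j, (s j).eval N e' = b j) ∧ |χ.eval N e' - χ.eval M e| < ε := by
  classical
  induction E using Finset.induction_on with
  | empty =>
    refine ⟨n, σ, a, fun j => .var j, fun _ => rfl, fun d hd => absurd hd (Finset.notMem_empty d),
      fun χ ε hε => ⟨b, fun _ => rfl, ?_⟩⟩
    rwa [hab, sub_self, abs_zero]
  | insert d E _ ih =>
    obtain ⟨k, τ, e, s, hs, ht, happ⟩ := ih
    obtain ⟨S, x⟩ := d
    refine ⟨k + 1, Fin.cons S τ, M.consTuple x e, fun j => (s j).shift S,
      fun j => (Tm.eval_shift M x e (s j)).trans (hs j), fun d hd => ?_, fun χ ε hε => ?_⟩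
    · rcases Finset.mem_insert.1 hd with rfl | hd
      · exact ⟨Tm.var (σ := (Fin.cons S τ : Fin (k + 1) → K.Srt)) 0, rfl⟩
      · obtain ⟨t, ht⟩ := ht d hd
        exact ⟨t.shift S, (Tm.eval_shift M x e t).trans ht⟩
    · let r := χ.eval M (M.consTuple x e)
      -- The infimum of `|χ - r|` over the new variable is `0` in `M`, attained at `x`. The
      -- induction hypothesis makes it less than `ε` at some `e'` in `N`, and a near-minimizer `y`
      -- extends `e'`.
      let ξ : BasicFormula K (Fin.cons S τ : Fin (k + 1) → K.Srt) :=
        .conn 1 ⟨fun v => |v 0 - r|, by fun_prop⟩ fun _ => χ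
      have hξ : ∀ (P : Struc K) (p), ξ.eval P p = |χ.eval P p - r| := fun _ _ => rfl
      obtain ⟨e', hs', he'⟩ := happ (.inf S ξ) ε hε
      have h0 : (BasicFormula.inf S ξ).eval M e = 0 := by
        refine le_antisymm ((ciInf_le (bddBelow_eval ξ e) x).trans_eq ?_)
          (le_ciInf fun y => ?_)
        · rw [hξ, sub_self, abs_zero]
        · rw [hξ]
          exact abs_nonneg _
      rw [h0, sub_zero] at he'
      obtain ⟨y, hy⟩ := exists_lt_of_ciInf_lt ((le_abs_self _).trans_lt he')
      exact ⟨N.consTuple y e', fun j => (Tm.eval_shift N y e' (s j)).trans (hs' j), hy⟩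

/-- Approximate realization of one formula suffices for approximate realization of finitely many
formulas. -/
theorem exists_tuple_forall_mem {k : ℕ} {τ : Fin k → K.Srt} {e : M.Tuple τ} {P : N.Tuple τ → Prop}
    (happ : ∀ (χ : BasicFormula K τ) (ε : ℝ), 0 < ε → ∃ e' : N.Tuple τ,
        P e' ∧ |χ.eval N e' - χ.eval M e| < ε)
    (Ξ : Finset (BasicFormula K τ)) {ε : ℝ} (hε : 0 < ε) :
    ∃ e' : N.Tuple τ, P e' ∧ ∀ χ ∈ Ξ, |χ.eval N e' - χ.eval M e| < ε := by
  let f : Fin Ξ.card → BasicFormula K τ := fun i => (Ξ.equivFin.symm i).1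
  let r : Fin Ξ.card → ℝ := fun i => (f i).eval M e
  -- A single connective, the sup-norm distance to the vector of values at `e`, controls all
  -- formulas of `Ξ` at once.
  obtain ⟨e', hP, he'⟩ := happ (.conn Ξ.card ⟨fun v => ‖v - r‖, by fun_prop⟩ f) ε hε
  refine ⟨e', hP, fun χ hχ => ?_⟩
  have h1 : ‖(fun i => (f i).eval N e') - r‖ < ε := by
    have h2 : |‖(fun i => (f i).eval N e') - r‖ - ‖r - r‖| < ε := he'
    rwa [sub_self r, norm_zero, sub_zero, abs_norm] at h2
  have h3 := (pi_norm_lt_iff hε).1 h1 (Ξ.equivFin ⟨χ, hχ⟩)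
  simpa [f, r] using h3

/-- A finite part of the elementary diagram of a structure: a tuple and a formula. -/
abbrev Condition (M : Struc K) : Type u :=
  Σ (k : ℕ) (τ : Fin k → K.Srt), M.Tuple τ × BasicFormula K τ

/-- Only finitely many elements of `M` occur in `Δ` and `a`. Each is named by a term over one finite
context, and is sent to the value of that term at an approximate realization of the context in `N`.
-/
theorem exists_approx_map (hab : ∀ ψ : BasicFormula K σ, ψ.eval M a = ψ.eval N b)
    (Δ : Finset (Condition M)) {ε : ℝ} (hε : 0 < ε) :
    ∃ h : ∀ S, M.carrier S → N.carrier S,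
      (∀ c ∈ Δ, |c.2.2.2.eval N (fun i => h _ (c.2.2.1 i)) - c.2.2.2.eval M c.2.2.1| < ε) ∧
      ∀ j, dist (h _ (a j)) (b j) < ε := by
  classical
  let E : Finset (Σ S, M.carrier S) :=
    (Δ.biUnion fun c => Finset.univ.image fun i => ⟨c.2.1 i, c.2.2.1 i⟩) ∪
      Finset.univ.image fun j => ⟨σ j, a j⟩
  have hE1 : ∀ c ∈ Δ, ∀ i, (⟨c.2.1 i, c.2.2.1 i⟩ : Σ S, M.carrier S) ∈ E := fun c hc i =>
    Finset.mem_union_left _ (Finset.mem_biUnion.2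
      ⟨c, hc, Finset.mem_image_of_mem _ (Finset.mem_univ i)⟩)
  have hE2 : ∀ j, (⟨σ j, a j⟩ : Σ S, M.carrier S) ∈ E := fun j =>
    Finset.mem_union_right _ (Finset.mem_image_of_mem _ (Finset.mem_univ j))
  obtain ⟨k, τ, e, s, hs, ht, happ⟩ := exists_context hab E
  choose t ht using ht
  -- The term chosen to name `a j` may differ from `s j`, whose value in `N` is exactly `b j`. The
  -- metric formulas keep their values close.
  let Ξ : Finset (BasicFormula K τ) :=
    (Δ.attach.image fun c => c.1.2.2.2.subst fun i => t _ (hE1 c.1 c.2 i)) ∪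
      Finset.univ.image fun j => .metric (t _ (hE2 j)) (s j)
  obtain ⟨e', hs', he'⟩ := exists_tuple_forall_mem happ Ξ hε
  let h : ∀ S, M.carrier S → N.carrier S := fun S x =>
    -- Outside `E` the value is irrelevant, so any point serves.
    if hx : ⟨S, x⟩ ∈ E then (t _ hx).eval N e' else (N.nonempty S).some
  have hh : ∀ S x (hx : ⟨S, x⟩ ∈ E), h S x = (t _ hx).eval N e' := fun S x hx => dif_pos hx
  refine ⟨h, fun c hc => ?_, fun j => ?_⟩
  · have key := he' (c.2.2.2.subst fun i => t _ (hE1 c hc i)) (Finset.mem_union_left _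
      (Finset.mem_image.2 ⟨⟨c, hc⟩, Finset.mem_attach _ _, rfl⟩))
    rw [BasicFormula.eval_subst, BasicFormula.eval_subst] at key
    simp only [ht] at key
    simpa only [hh _ _ (hE1 c hc _)] using key
  · have key := he' (.metric (t _ (hE2 j)) (s j)) (Finset.mem_union_right _
      (Finset.mem_image_of_mem _ (Finset.mem_univ j)))
    simp only [BasicFormula.eval, ht, hs, hs', dist_self, sub_zero, abs_of_nonneg dist_nonneg]
      at key
    rwa [hh _ _ (hE2 j)]

/-- If `a` and `b` have the same type, then `M` embeds elementarily in an ultrapower of `N` such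
that `a` is mapped to `b`. -/
theorem exists_elemEmb_ultraprod (hab : ∀ ψ : BasicFormula K σ, ψ.eval M a = ψ.eval N b) :
    ∃ (I : Type u) (U : Ultrafilter I) (g : ElemEmb M (ultraprod (fun _ : I => N) U)),
      ∀ j, g.toFun _ (a j) = ultraMk (fun _ : I => N) U fun _ => b j := by
  classical
  -- Indices pair a finite part of the diagram with a precision. An ultrafilter below `atTop`
  -- eventually contains every condition and sends the errors to `0`.
  let I := Finset (Condition M) × ℕ
  have hI : ∀ i : I, (0 : ℝ) < 1 / (i.2 + 1) := fun i => Nat.one_div_pos_of_nat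
  choose h h1 h2 using fun i : I => exists_approx_map hab i.1 (hI i)
  let U : Ultrafilter I := Ultrafilter.of Filter.atTop
  have hU : (U : Filter I) ≤ Filter.atTop := Ultrafilter.of_le _
  have hε : Filter.Tendsto (fun i : I => (1 : ℝ) / (i.2 + 1)) U (𝓝 0) :=
    (tendsto_one_div_add_atTop_nhds_zero_nat.comp
      (Filter.prod_atTop_atTop_eq (α := Finset (Condition M)) (β := ℕ) ▸
        Filter.tendsto_snd)).mono_left hU
  let g : ElemEmb M (ultraprod (fun _ : I => N) U) :=
    ElemEmb.ofMapFormula (fun S x => ultraMk (fun _ : I => N) U fun i => h i S x)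
      fun {m τ} φ c => by
        refine tendsto_nhds_unique (tendsto_eval_ultraprod (fun _ : I => N) U φ
          fun i j => h i _ (c j)) (tendsto_iff_dist_tendsto_zero.2
            (squeeze_zero' (Filter.Eventually.of_forall fun _ => dist_nonneg) ?_ hε))
        filter_upwards [hU (Filter.eventually_ge_atTop ({⟨m, τ, c, φ⟩}, 0))] with i hi
        exact (h1 i ⟨m, τ, c, φ⟩ (Finset.singleton_subset_iff.1 hi.1)).le
  refine ⟨I, U, g, fun j => dist_eq_zero.1 (tendsto_nhds_unique
    (tendsto_dist_ultraMk (fun _ : I => N) U _ _)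
    (squeeze_zero (fun _ => dist_nonneg) (fun i => (h2 i j).le) hε))⟩

end Approximation

/-! ### From fullness to uniform approximation -/

/-- If the reduct functor is full, then the type of a tuple in the sublanguage determines the
values of all formulas. -/
theorem eval_eq_of_full {L : Lang.{u}} {L' : Sublang L} {T : Theory L}
    (hF : (reductFunctor T L').Full) {M N : Mod T} {n : ℕ} {σ : Fin n → L.Srt}
    {a : M.struc.Tuple σ} {b : N.struc.Tuple σ}
    (hab : ∀ ψ : BasicFormula L'.lang σ,
      ψ.eval (M.struc.reduct L') a = ψ.eval (N.struc.reduct L') b)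
    (φ : BasicFormula L σ) : φ.eval M.struc a = φ.eval N.struc b := by
  obtain ⟨I, U, g, hg⟩ := exists_elemEmb_ultraprod hab
  let P : Mod T := ⟨ultraprod (fun _ : I => N.struc) U, ultraprod_satisfies _ U fun _ => N.sat⟩
  -- The ultrapower of the reduct is definitionally the reduct of the ultrapower, so `g` is already
  -- a morphism between objects in the image of the functor.
  let g' : (reductFunctor T L').obj M ⟶ (reductFunctor T L').obj P := g
  obtain ⟨f, hf⟩ := (reductFunctor T L').map_surjective g'
  have hfg : ∀ S x, ElemEmb.toFun f S x = g.toFun S x := fun S x =>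
    congrFun (congrFun (congrArg ElemEmb.toFun hf) S) x
  have h1 := ElemEmb.map_formula f φ a
  simp only [hfg] at h1
  have h2 : (fun j => g.toFun _ (a j)) = fun j => ultraMk (fun _ : I => N.struc) U fun _ => b j :=
    funext hg
  rw [← h1]
  refine (congrArg (φ.eval P.struc) h2).trans ?_
  exact tendsto_nhds_unique (tendsto_eval_ultraprod (fun _ : I => N.struc) U φ fun _ => b)
    tendsto_const_nhds

section Definability

variable {L : Lang.{u}} {L' : Sublang L} {T : Theory L} {n : ℕ} {σ : Fin n → L.Srt}

/-- Closeness of the values of finitely many formulas of the sublanguage forces closeness of the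
values of a given formula. -/
theorem exists_finset_of_full (hF : (reductFunctor T L').Full) (φ : BasicFormula L σ) {ε : ℝ}
    (hε : 0 < ε) :
    ∃ (Δ : Finset (BasicFormula L'.lang σ)) (δ : ℝ), 0 < δ ∧
      ∀ p q : (Σ M : Mod T, M.struc.Tuple σ),
        (∀ ψ ∈ Δ, |ψ.eval (p.1.struc.reduct L') p.2 - ψ.eval (q.1.struc.reduct L') q.2| < δ) →
        |φ.eval p.1.struc p.2 - φ.eval q.1.struc q.2| < ε := by
  classical
  by_contra! hcon
  let I := Finset (BasicFormula L'.lang σ) × ℕ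
  have hI : ∀ i : I, (0 : ℝ) < 1 / (i.2 + 1) := fun i => Nat.one_div_pos_of_nat
  -- The ultraproducts of these counterexamples carry tuples with equal `L'`-types whose `φ`-values
  -- still differ by at least `ε`.
  choose p q hpq hφ using fun i : I => hcon i.1 _ (hI i)
  let U : Ultrafilter I := Ultrafilter.of Filter.atTop
  have hU : (U : Filter I) ≤ Filter.atTop := Ultrafilter.of_le _
  have hlim : Filter.Tendsto (fun i : I => (1 : ℝ) / (i.2 + 1)) U (𝓝 0) :=
    (tendsto_one_div_add_atTop_nhds_zero_nat.comp
      (Filter.prod_atTop_atTop_eq (α := Finset (BasicFormula L'.lang σ)) (β := ℕ) ▸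
        Filter.tendsto_snd)).mono_left hU
  let P : Mod T := ⟨ultraprod (fun i => (p i).1.struc) U, ultraprod_satisfies _ U fun i => (p i).1.sat⟩
  let Q : Mod T := ⟨ultraprod (fun i => (q i).1.struc) U, ultraprod_satisfies _ U fun i => (q i).1.sat⟩
  let a : P.struc.Tuple σ := fun j => ultraMk (fun i => (p i).1.struc) U fun i => (p i).2 j
  let b : Q.struc.Tuple σ := fun j => ultraMk (fun i => (q i).1.struc) U fun i => (q i).2 j
  have hP : ∀ χ : BasicFormula L σ, Filter.Tendsto (fun i => χ.eval (p i).1.struc (p i).2) U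
      (𝓝 (χ.eval P.struc a)) := fun χ =>
    tendsto_eval_ultraprod (fun i => (p i).1.struc) U χ fun i => (p i).2
  have hQ : ∀ χ : BasicFormula L σ, Filter.Tendsto (fun i => χ.eval (q i).1.struc (q i).2) U
      (𝓝 (χ.eval Q.struc b)) := fun χ =>
    tendsto_eval_ultraprod (fun i => (q i).1.struc) U χ fun i => (q i).2
  have hab : ∀ ψ : BasicFormula L'.lang σ,
      ψ.eval (P.struc.reduct L') a = ψ.eval (Q.struc.reduct L') b := fun ψ => by
    rw [← BasicFormula.eval_incl, ← BasicFormula.eval_incl]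
    refine sub_eq_zero.1 (tendsto_nhds_unique ((hP ψ.incl).sub (hQ ψ.incl))
      (squeeze_zero_norm' ?_ hlim))
    filter_upwards [hU (Filter.eventually_ge_atTop ({ψ}, 0))] with i hi
    rw [BasicFormula.eval_incl, BasicFormula.eval_incl]
    exact (hpq i ψ (Finset.singleton_subset_iff.1 hi.1)).le
  have h1 := ge_of_tendsto' ((hP φ).sub (hQ φ)).abs hφ
  rw [eval_eq_of_full hF hab φ, sub_self, abs_zero] at h1
  exact hε.not_ge h1

/-- A function on a set `X` that is approximately determined by a map to a metric space is
approximately a continuous function of that map. -/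
theorem exists_continuousMap_approx {X : Type*} {Y : Type*} [PseudoMetricSpace Y] (f : X → ℝ)
    (v : X → Y) {B : ℝ} (hB : ∀ x, |f x| ≤ B) {ε δ : ℝ} (hδ : 0 < δ) (hε : 0 ≤ ε)
    (h : ∀ x y, dist (v x) (v y) < δ → |f x - f y| ≤ ε) :
    ∃ g : C(Y, ℝ), ∀ x, |f x - g (v x)| ≤ ε := by
  rcases isEmpty_or_nonempty X with hX | hX
  · exact ⟨0, fun x => isEmptyElim x⟩
  have hB0 : 0 ≤ B := (abs_nonneg _).trans (hB hX.some)
  have hC : 0 ≤ 2 * B / δ := by positivity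
  have hbdd : ∀ y, BddBelow (Set.range fun x => f x + 2 * B / δ * dist y (v x)) := fun y =>
    ⟨-B, by
      rintro _ ⟨x, rfl⟩
      exact (abs_le.1 (hB x)).1.trans (le_add_of_nonneg_right (mul_nonneg hC dist_nonneg))⟩
  -- McShane-type extension. At distance at least `δ` the penalty is at least `2 * B`, which absorbs
  -- the whole oscillation of `f`, so only nearby points matter.
  let g : Y → ℝ := fun y => ⨅ x, (f x + 2 * B / δ * dist y (v x))
  have hg : LipschitzWith (Real.toNNReal (2 * B / δ)) g := by
    refine LipschitzWith.of_le_add_mul _ fun y z => ?_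
    rw [Real.coe_toNNReal _ hC]
    refine le_of_forall_pos_le_add fun r hr => ?_
    obtain ⟨x, hx⟩ := exists_lt_of_ciInf_lt (lt_add_of_pos_right (g z) hr)
    refine (ciInf_le (hbdd y) x).trans ?_
    have := mul_le_mul_of_nonneg_left (dist_triangle y z (v x)) hC
    linarith
  refine ⟨⟨g, hg.continuous⟩, fun x => ?_⟩
  have h1 : g (v x) ≤ f x := (ciInf_le (hbdd _) x).trans_eq (by simp)
  have h2 : f x - ε ≤ g (v x) := by
    refine le_ciInf fun y => ?_
    rcases lt_or_ge (dist (v x) (v y)) δ with hd | hd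
    · have h3 := (abs_le.1 (h x y hd)).2
      have h4 := mul_nonneg hC (dist_nonneg (x := v x) (y := v y))
      linarith
    · have h3 := (abs_le.1 (hB x)).2
      have h4 := (abs_le.1 (hB y)).1
      have h5 : 2 * B ≤ 2 * B / δ * dist (v x) (v y) := by
        rw [div_mul_eq_mul_div, le_div_iff₀ hδ]
        exact mul_le_mul_of_nonneg_left hd (by positivity)
      linarith
  exact abs_le.2 ⟨by simp only [ContinuousMap.coe_mk]; linarith,
    by simp only [ContinuousMap.coe_mk]; linarith⟩

/-- Basic formulas are approximated in all models by basic formulas of the sublanguage. -/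
theorem exists_basicFormula_approx (hF : (reductFunctor T L').Full) (φ : BasicFormula L σ) {ε : ℝ}
    (hε : 0 < ε) :
    ∃ ψ : BasicFormula L'.lang σ, ∀ (M : Mod T) (a : M.struc.Tuple σ),
      |φ.eval M.struc a - ψ.eval (M.struc.reduct L') a| ≤ ε := by
  obtain ⟨Δ, δ, hδ, h⟩ := exists_finset_of_full hF φ hε
  obtain ⟨B, hB⟩ := φ.exists_bound
  let ψ : Fin Δ.card → BasicFormula L'.lang σ := fun i => (Δ.equivFin.symm i).1
  obtain ⟨g, hg⟩ := exists_continuousMap_approx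
    (fun p : (Σ M : Mod T, M.struc.Tuple σ) => φ.eval p.1.struc p.2)
    (fun p => fun i => (ψ i).eval (p.1.struc.reduct L') p.2) (fun p => hB _ _) hδ hε.le
    fun p q hpq => (h p q fun χ hχ => by
      have h1 := (dist_pi_lt_iff hδ).1 hpq (Δ.equivFin ⟨χ, hχ⟩)
      simpa [ψ, Real.dist_eq] using h1).le
  exact ⟨.conn _ g ψ, fun M a => hg ⟨M, a⟩⟩

theorem lipschitzWith_formEval (M : Mod T) (a : M.struc.Tuple σ) :
    LipschitzWith 1 fun φ : Form T σ => Form.eval M φ a :=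
  LipschitzWith.completion_extension (LipschitzWith.of_dist_le_mul fun φ ψ => by
    rw [Real.dist_eq, NNReal.coe_one, one_mul]
    exact abs_sub_le_distT φ ψ M a)

/-- Formulas are approximated in all structures by basic formulas. -/
theorem Form.exists_basicFormula_approx (φ : Form T σ) {ε : ℝ} (hε : 0 < ε) :
    ∃ ψ : BasicFormula L σ, ∀ (M : Mod T) (a : M.struc.Tuple σ),
      |Form.eval M φ a - ψ.eval M.struc a| ≤ ε := by
  obtain ⟨ψ, hψ⟩ := (UniformSpace.Completion.denseRange_coe (α := PreForm T σ)).exists_dist_lt φ hε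
  refine ⟨ψ, fun M a => ?_⟩
  have h := (lipschitzWith_formEval M a).dist_le_mul φ ψ
  rw [Form.eval_coe, NNReal.coe_one, one_mul] at h
  exact h.trans hψ.le

/-! ### Forced limits and the definability theorem -/

/-- The connective that moves `x` towards `y` by at most `r`. -/
def moveTowards (r : ℝ) : C(Fin 2 → ℝ, ℝ) :=
  ⟨fun v => v 0 + max (-r) (min r (v 1 - v 0)), by fun_prop⟩

/-- The forced limit of a sequence of basic formulas: consecutive members are uniformly close in
all structures. -/
noncomputable def forcedSeq (ψ : ℕ → BasicFormula L σ) : ℕ → BasicFormula L σ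
  | 0 => ψ 0
  -- The bound is `1 / 2 ^ k`, written in the shape `C / 2 / 2 ^ k` of the geometric Cauchy
  -- criterion with `C = 2`.
  | k + 1 => .conn 2 (moveTowards (2 / 2 / 2 ^ k)) ![forcedSeq ψ k, ψ (k + 1)]

theorem eval_forcedSeq_succ (ψ : ℕ → BasicFormula L σ) (k : ℕ) (M : Struc L) (a : M.Tuple σ) :
    (forcedSeq ψ (k + 1)).eval M a = (forcedSeq ψ k).eval M a +
      max (-(2 / 2 / 2 ^ k)) (min (2 / 2 / 2 ^ k)
        ((ψ (k + 1)).eval M a - (forcedSeq ψ k).eval M a)) := rfl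

theorem abs_forcedSeq_sub_le (ψ : ℕ → BasicFormula L σ) (k : ℕ) (M : Struc L) (a : M.Tuple σ) :
    |(forcedSeq ψ k).eval M a - (forcedSeq ψ (k + 1)).eval M a| ≤ 2 / 2 / 2 ^ k := by
  have h : (0 : ℝ) ≤ 2 / 2 / 2 ^ k := by positivity
  rw [abs_sub_comm, eval_forcedSeq_succ, add_sub_cancel_left]
  exact abs_le.2 ⟨le_max_left _ _, max_le (by linarith) (min_le_left _ _)⟩

/-- Where the original sequence already moves by no more than the allowed steps, the truncation is
inactive. -/
theorem eval_forcedSeq (ψ : ℕ → BasicFormula L σ) (M : Struc L) (a : M.Tuple σ)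
    (h : ∀ k, |(ψ (k + 1)).eval M a - (ψ k).eval M a| ≤ 2 / 2 / 2 ^ k) (k : ℕ) :
    (forcedSeq ψ k).eval M a = (ψ k).eval M a := by
  induction k with
  | zero => rfl
  | succ k ih =>
    rw [eval_forcedSeq_succ, ih, min_eq_right (abs_le.1 (h k)).2, max_eq_right (abs_le.1 (h k)).1,
      add_sub_cancel]

/-- The forced limits converge in the space of formulas. -/
theorem exists_tendsto_forcedSeq (ψ : ℕ → BasicFormula L σ) :
    ∃ χ : Formula L σ, ∀ (M : Str L) (a : M.struc.Tuple σ),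
      Filter.Tendsto (fun k => (forcedSeq ψ k).eval M.struc a) Filter.atTop
        (𝓝 (Form.eval M χ a)) := by
  let x : ℕ → PreForm (∅ : Theory L) σ := forcedSeq ψ
  have hx : CauchySeq fun k => (x k : Formula L σ) := by
    refine cauchySeq_of_le_geometric_two (C := 2) fun k => ?_
    rw [UniformSpace.Completion.dist_eq]
    exact Real.iSup_le (fun p => abs_forcedSeq_sub_le ψ k _ _) (by positivity)
  obtain ⟨χ, hχ⟩ := cauchySeq_tendsto_of_complete hx
  refine ⟨χ, fun M a => ?_⟩
  have h := ((lipschitzWith_formEval M a).continuous.tendsto χ).comp hχ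
  exact h.congr fun k => Form.eval_coe M (x k) a

/-- **Beth definability**, for a full reduct functor. -/
theorem exists_tEquiv_of_full (hF : (reductFunctor T L').Full) (φ : Formula L σ) :
    ∃ ψ : Formula L'.lang σ, TEquiv T φ ψ := by
  have key : ∀ k : ℕ, ∃ ψ : BasicFormula L'.lang σ, ∀ (M : Mod T) (a : M.struc.Tuple σ),
      |Form.eval M.struc.toStr φ a - ψ.eval (M.struc.reduct L') a| ≤ 1 / 2 / 2 ^ k := fun k => by
    -- Two errors of `1 / 4 / 2 ^ k` give `1 / 2 / 2 ^ k`, so on models of `T` consecutive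
    -- approximations differ by at most `2 / 2 / 2 ^ k`, the step allowed in `forcedSeq`.
    obtain ⟨φ', hφ'⟩ := φ.exists_basicFormula_approx (ε := 1 / 4 / 2 ^ k) (by positivity)
    obtain ⟨ψ, hψ⟩ := exists_basicFormula_approx hF φ' (ε := 1 / 4 / 2 ^ k) (by positivity)
    refine ⟨ψ, fun M a => (abs_sub_le _ (φ'.eval M.struc a) _).trans
      ((add_le_add (hφ' M.struc.toStr a) (hψ M a)).trans_eq (by ring))⟩
  choose ψ hψ using key
  obtain ⟨χ, hχ⟩ := exists_tendsto_forcedSeq ψ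
  refine ⟨χ, fun M hM a => tendsto_nhds_unique (f := fun k => (ψ k).eval (M.reduct L') a)
    (l := Filter.atTop) ?_ ?_⟩
  · rw [tendsto_iff_dist_tendsto_zero]
    refine squeeze_zero (fun _ => dist_nonneg)
      (fun k => (dist_comm _ _).trans_le (hψ k ⟨M, hM⟩ a)) ?_
    have := (tendsto_pow_atTop_nhds_zero_of_lt_one (r := (1 / 2 : ℝ)) (by norm_num)
      (by norm_num)).const_mul (1 / 2)
    simpa [div_eq_mul_inv] using this
  · refine (hχ (M.reduct L').toStr a).congr fun k => eval_forcedSeq ψ (M.reduct L') a (fun k => ?_) k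
    refine (abs_sub_le _ (Form.eval M.toStr φ a) _).trans ?_
    have h1 := hψ (k + 1) ⟨M, hM⟩ a
    rw [abs_sub_comm] at h1
    have h2 : (1 : ℝ) / 2 / 2 ^ (k + 1) ≤ 1 / 2 / 2 ^ k := by gcongr <;> norm_num
    exact (add_le_add (h1.trans h2) (hψ k ⟨M, hM⟩ a)).trans_eq (by ring)

end Definability

/-- A functor that is an equivalence onto its essential image is full. -/
theorem full_of_isEquivalence_toEssImage {C D : Type*} [Category* C] [Category* D] (F : C ⥤ D)
    (hF : F.toEssImage.IsEquivalence) : F.Full :=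
  -- `F` is isomorphic to `F.toEssImage` followed by the inclusion of a full subcategory, a
  -- composite of full functors.
  Functor.Full.of_iso F.toEssImageCompι

end ContLogic

theorem mainTheorem6 (L : ContLogic.Lang.{u}) (L' : ContLogic.Sublang L)
    (T : ContLogic.Theory L)
    (hF : (ContLogic.reductFunctor T L').toEssImage.IsEquivalence)
    {n : ℕ} (σ : Fin n → L.Srt) (φ : ContLogic.Formula L σ) :
    ∃ ψ : ContLogic.Formula L'.lang σ, ContLogic.TEquiv T φ ψ :=
  ContLogic.exists_tEquiv_of_full (ContLogic.full_of_isEquivalence_toEssImage _ hF) φ
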